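/- Let $K$ be an algebraically closed field of characteristic zero. An associative superalgebra is a (not necessarily unital) finite-dimensional associative $K$-algebra $A=A_{\bar 0}\oplus A_{\bar 1}$ with $A_\alpha A_\beta\subseteq A_{\alpha+\beta}$ for $\alpha,\beta\in\mathbb Z/2$. It is called odd-symmetric, written $(A,B)$, if it carries a bilinear form $B:A\times A\to K$ that is odd ($B(A_{\bar 0},A_{\bar 0})=B(A_{\bar 1},A_{\bar 1})=0$), supersymmetric ($B(x,y)=(-1)^{|x||y|}B(y,x)$ for homogeneous $x,y$), associative ($B(xy,z)=B(x,yz)$) and non-degenerate. For $n\ge 1$ let $Q_n(K)$ be the superalgebra of all block matrices $\begin{pmatrix}a&b\\ b&a\end{pmatrix}$ with $a,b\in M_n(K)$, where the even part is given by $b=0$ and the odd part by $a=0$. For an associative algebra $R$, the semi-direct product of $R$ by $P(R^*)$ by means of $(L^*,R^*)$ is the odd-symmetric associative superalgebra $R\oplus P(R^*)$ with even part $R$ and odd part the dual space $R^*$, with product $$(x+f)(y+h)=xy+L^*(x)(h)+R^*(y)(f),\qquad L^*(x)(h)(z)=h(zx),\quad R^*(y)(f)(z)=f(yz),$$ and with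 the form $\widetilde B(f,x)=\widetilde B(x,f)=f(x)$ for $x\in R$, $f\in R^*$, and $\widetilde B(R,R)=\widetilde B(R^*,R^*)=0$. **Theorem.** Let $(A,B)$ be an odd-symmetric associative superalgebra such that $A_{\bar 0}$ is a semisimple associative algebra (i.e. $A_{\bar 0}$ has no non-zero nilpotent two-sided ideal). Then $A$ is the direct sum of finitely many graded two-sided ideals $A_1,\dots,A_m$ that are pairwise orthogonal with respect to $B$, such that each $A_i$, with the induced grading and the restriction of $B$, is an odd-symmetric associative superalgebra, and for each $i$ there is an $n\ge 1$ such that either 1. $A_i$ is isomorphic, as a superalgebra, to $Q_n(K)$; or 2. $A_i$ is isomorphic to the semi-direct product $M_n(K)\oplus P(M_n(K)^*)$ of $M_n(K)$ by $P(M_n(K)^*)$ by means of $(L^*,R^*)$, by an isomorphism of superalgebras that carries the restriction of $B$ to $\widetilde B$. -/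

import Mathlib

/-- A (not necessarily unital) associative `K`-algebra `A` with a `ℤ/2`-grading `𝒜` is an
associative superalgebra: `A = 𝒜 0 ⊕ 𝒜 1` and `𝒜 i * 𝒜 j ⊆ 𝒜 (i + j)`. -/
structure IsSuperalgebra {K A : Type*} [Field K] [NonUnitalRing A] [Module K A]
    (𝒜 : ZMod 2 → Submodule K A) : Prop where
  internal : DirectSum.IsInternal 𝒜
  mul_mem : ∀ (i j : ZMod 2) (x y : A), x ∈ 𝒜 i → y ∈ 𝒜 j → x * y ∈ 𝒜 (i + j)

/-- `(A, B)` is an odd-symmetric associative superalgebra: `A` is an associative superalgebra and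
`B` is an odd, supersymmetric, associative and non-degenerate bilinear form on it. -/
structure IsOddSymmetric {K A : Type*} [Field K] [NonUnitalRing A] [Module K A]
    (𝒜 : ZMod 2 → Submodule K A) (B : LinearMap.BilinForm K A) : Prop
    extends IsSuperalgebra 𝒜 where
  odd : ∀ (i j : ZMod 2) (x y : A), x ∈ 𝒜 i → y ∈ 𝒜 j → i + j + 1 ≠ 0 → B x y = 0
  supersymm : ∀ (i j : ZMod 2) (x y : A), x ∈ 𝒜 i → y ∈ 𝒜 j →
    B x y = (-1) ^ (i.val * j.val) * B y x
  assoc : ∀ x y z : A, B (x * y) z = B x (y * z)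
  nondeg : ∀ x : A, (∀ y : A, B x y = 0) → x = 0

/-- The even part of an associative superalgebra, as a (non-unital) associative algebra. -/
def IsSuperalgebra.evenPart {K A : Type*} [Field K] [NonUnitalRing A] [Module K A]
    {𝒜 : ZMod 2 → Submodule K A} (h : IsSuperalgebra 𝒜) : NonUnitalSubalgebra K A :=
  { 𝒜 0 with mul_mem' := fun {x y} hx hy => h.mul_mem 0 0 x y hx hy }

/-- A linear subspace is a two-sided ideal. -/
structure IsTwoSidedIdeal {K A : Type*} [Field K] [NonUnitalRing A] [Module K A]
    (I : Submodule K A) : Prop where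
  mul_mem_left : ∀ a x : A, x ∈ I → a * x ∈ I
  mul_mem_right : ∀ a x : A, x ∈ I → x * a ∈ I

/-- `mulPow I k` is the power `I ^ (k + 1)`: the linear span of all products of `k + 1` elements
of `I`. -/
def mulPow {K A : Type*} [Field K] [NonUnitalRing A] [Module K A] (I : Submodule K A) :
    ℕ → Submodule K A
  | 0 => I
  | k + 1 => Submodule.span K {z | ∃ x ∈ I, ∃ y ∈ mulPow I k, x * y = z}

/-- A finite-dimensional (not necessarily unital) associative algebra is semisimple if its only
nilpotent two-sided ideal is zero. -/
def IsSemisimpleAssocAlgebra (K R : Type*) [Field K] [NonUnitalRing R] [Module K R] : Prop :=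
  ∀ I : Submodule K R, IsTwoSidedIdeal I → (∃ k : ℕ, mulPow I k = ⊥) → I = ⊥

/-- A graded two-sided ideal, regarded as a subalgebra: it absorbs products on both sides and is
the sum of its homogeneous parts. -/
structure IsGradedIdeal {K A : Type*} [Field K] [NonUnitalRing A] [Module K A]
    (𝒜 : ZMod 2 → Submodule K A) (I : NonUnitalSubalgebra K A) : Prop
    extends IsTwoSidedIdeal I.toSubmodule where
  graded : I.toSubmodule ≤ (I.toSubmodule ⊓ 𝒜 0) ⊔ (I.toSubmodule ⊓ 𝒜 1)

/-- The grading induced on a subalgebra. -/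
def restrictGrading {K A : Type*} [Field K] [NonUnitalRing A] [Module K A]
    (𝒜 : ZMod 2 → Submodule K A) (S : NonUnitalSubalgebra K A) : ZMod 2 → Submodule K S :=
  fun i => (𝒜 i).comap S.toSubmodule.subtype

/-- The bilinear form induced on a subalgebra. -/
def restrictForm {K A : Type*} [Field K] [NonUnitalRing A] [Module K A]
    (B : LinearMap.BilinForm K A) (S : NonUnitalSubalgebra K A) : LinearMap.BilinForm K S :=
  B.compl₁₂ S.toSubmodule.subtype S.toSubmodule.subtype

/-- An isomorphism of associative superalgebras: a linear bijection that preserves products and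
degrees. -/
structure SuperalgebraIso {K A A' : Type*} [Field K] [NonUnitalRing A] [Module K A]
    [NonUnitalRing A'] [Module K A'] (𝒜 : ZMod 2 → Submodule K A)
    (𝒜' : ZMod 2 → Submodule K A') extends A ≃ₗ[K] A' where
  map_mul : ∀ x y : A, toFun (x * y) = toFun x * toFun y
  mem_iff : ∀ (i : ZMod 2) (x : A), toFun x ∈ 𝒜' i ↔ x ∈ 𝒜 i

/-- The algebra `Q_n(K)` of all `2n × 2n` block matrices `(a b; b a)`. -/
def queer (K : Type*) [Field K] (n : ℕ) :
    NonUnitalSubalgebra K (Matrix (Fin n ⊕ Fin n) (Fin n ⊕ Fin n) K) where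
  carrier := {M | ∃ a b : Matrix (Fin n) (Fin n) K, M = Matrix.fromBlocks a b b a}
  zero_mem' := ⟨0, 0, by simp⟩
  add_mem' := by
    rintro _ _ ⟨a, b, rfl⟩ ⟨c, d, rfl⟩
    exact ⟨a + c, b + d, by simp [Matrix.fromBlocks_add]⟩
  smul_mem' := by
    rintro c _ ⟨a, b, rfl⟩
    exact ⟨c • a, c • b, by simp [Matrix.fromBlocks_smul]⟩
  mul_mem' := by
    rintro _ _ ⟨a, b, rfl⟩ ⟨c, d, rfl⟩
    exact ⟨a * c + b * d, a * d + b * c, by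
      simp [Matrix.fromBlocks_multiply, add_comm]⟩

/-- The grading of `Q_n(K)`: the matrices `(a 0; 0 a)` are even and the matrices `(0 b; b 0)` are
odd. -/
def queerGrading (K : Type*) [Field K] (n : ℕ) (i : ZMod 2) : Submodule K (queer K n) where
  carrier := {M | if i = 0
    then ∃ a : Matrix (Fin n) (Fin n) K, M.1 = Matrix.fromBlocks a 0 0 a
    else ∃ b : Matrix (Fin n) (Fin n) K, M.1 = Matrix.fromBlocks 0 b b 0}
  zero_mem' := by
    simp only [Set.mem_ofPred_eq]
    split_ifs <;> exact ⟨0, by simp⟩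
  add_mem' := by
    intro x y
    simp only [Set.mem_ofPred_eq]
    split_ifs <;> rintro ⟨a, ha⟩ ⟨b, hb⟩ <;>
      exact ⟨a + b, by simp [ha, hb, Matrix.fromBlocks_add]⟩
  smul_mem' := by
    intro c x
    simp only [Set.mem_ofPred_eq]
    split_ifs <;> rintro ⟨a, ha⟩ <;>
      exact ⟨c • a, by simp [ha, Matrix.fromBlocks_smul]⟩

/-- The vector space `R ⊕ P(R^*)` underlying the semi-direct product of an associative algebra `R`
by `P(R^*)` by means of `(L^*, R^*)`. -/
def SemidirectDual (K R : Type*) [Field K] [NonUnitalRing R] [Module K R] : Type _ :=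
  R × Module.Dual K R

namespace SemidirectDual

instance instAddCommGroup (K R : Type*) [Field K] [NonUnitalRing R] [Module K R] :
    AddCommGroup (SemidirectDual K R) :=
  inferInstanceAs (AddCommGroup (R × Module.Dual K R))

instance instModule (K R : Type*) [Field K] [NonUnitalRing R] [Module K R] :
    Module K (SemidirectDual K R) :=
  inferInstanceAs (Module K (R × Module.Dual K R))

/-- The product `(x + f)(y + h) = x y + L^*(x)(h) + R^*(y)(f)`, where `L^*(x)(h) = h ∘ R_x` is the
map `z ↦ h (z x)` and `R^*(y)(f) = f ∘ L_y` is the map `z ↦ f (y z)`. -/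
instance instMul (K R : Type*) [Field K] [NonUnitalRing R] [Module K R]
    [IsScalarTower K R R] [SMulCommClass K R R] : Mul (SemidirectDual K R) where
  mul p q := (p.1 * q.1,
    q.2 ∘ₗ LinearMap.mulRight K p.1 + p.2 ∘ₗ LinearMap.mulLeft K q.1)

instance instNonUnitalRing (K R : Type*) [Field K] [NonUnitalRing R] [Module K R]
    [IsScalarTower K R R] [SMulCommClass K R R] : NonUnitalRing (SemidirectDual K R) where
  left_distrib p q r := Prod.ext (mul_add p.1 q.1 r.1) <| LinearMap.ext fun z => by
    change (q.2 + r.2) (z * p.1) + p.2 ((q.1 + r.1) * z)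
      = (q.2 (z * p.1) + p.2 (q.1 * z)) + (r.2 (z * p.1) + p.2 (r.1 * z))
    rw [add_mul, map_add, LinearMap.add_apply]; abel
  right_distrib p q r := Prod.ext (add_mul p.1 q.1 r.1) <| LinearMap.ext fun z => by
    change r.2 (z * (p.1 + q.1)) + (p.2 + q.2) (r.1 * z)
      = (r.2 (z * p.1) + p.2 (r.1 * z)) + (r.2 (z * q.1) + q.2 (r.1 * z))
    rw [mul_add, map_add, LinearMap.add_apply]; abel
  zero_mul p := Prod.ext (zero_mul p.1) <| LinearMap.ext fun z => by
    change p.2 (z * 0) + (0 : Module.Dual K R) (p.1 * z) = 0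
    simp
  mul_zero p := Prod.ext (mul_zero p.1) <| LinearMap.ext fun z => by
    change (0 : Module.Dual K R) (z * p.1) + p.2 (0 * z) = 0
    simp
  mul_assoc p q r := Prod.ext (mul_assoc p.1 q.1 r.1) <| LinearMap.ext fun z => by
    change r.2 (z * (p.1 * q.1)) + (q.2 (r.1 * z * p.1) + p.2 (q.1 * (r.1 * z)))
      = (r.2 (z * p.1 * q.1) + q.2 (r.1 * (z * p.1))) + p.2 (q.1 * r.1 * z)
    simp only [mul_assoc]; abel

/-- The grading of the semi-direct product: `R` is the even part and `P(R^*)` the odd part. -/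
def grading (K R : Type*) [Field K] [NonUnitalRing R] [Module K R] (i : ZMod 2) :
    Submodule K (SemidirectDual K R) :=
  if i = 0 then LinearMap.range (LinearMap.inl K R (Module.Dual K R))
  else LinearMap.range (LinearMap.inr K R (Module.Dual K R))

/-- The form on the semi-direct product: `B (f, x) = B (x, f) = f x`, and `B` vanishes on `R × R`
and on `P(R^*) × P(R^*)`. -/
def form (K R : Type*) [Field K] [NonUnitalRing R] [Module K R] :
    LinearMap.BilinForm K (SemidirectDual K R) :=
  LinearMap.mk₂ K (fun p q => q.2 p.1 + p.2 q.1)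
    (fun p p' q => by
      change q.2 (p.1 + p'.1) + (p.2 + p'.2) q.1 = _
      rw [map_add, LinearMap.add_apply]; abel)
    (fun c p q => by
      change q.2 (c • p.1) + (c • p.2) q.1 = _
      rw [map_smul, LinearMap.smul_apply, smul_add])
    (fun p q q' => by
      change (q.2 + q'.2) p.1 + p.2 (q.1 + q'.1) = _
      rw [map_add, LinearMap.add_apply]; abel)
    (fun c p q => by
      change (c • q.2) p.1 + p.2 (c • q.1) = _
      rw [map_smul, LinearMap.smul_apply, smul_add])

end SemidirectDual

/-! ### Wedderburn theory without assuming a unit. -/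

section NonunitalSemisimple

variable {K R : Type*} [Field K] [NonUnitalRing R] [Module K R] [IsScalarTower K R R]
  [SMulCommClass K R R] [FiniteDimensional K R]

/-! An odd non-degenerate form pairs the even and odd parts perfectly, so the odd part is the dual
of `A_0` as a bimodule and everything about it can be tested against even elements (`odd_ext`).

Having no nilpotent ideal, `A_0` is unital and a product of matrix algebras. Its unit and its
central idempotents `e_i` keep these roles on `A`: left unit and central elements. Hence `A` is the
sum of the graded ideals `e_i A`, which associativity of `B` makes orthogonal and non-degenerate.

On one block with even part `M_n(K)`, the trace is represented by an odd `θ`. Since the trace is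
symmetric, `θ` commutes with `M_n(K)`; since the trace form is non-degenerate, the odd part is
`M_n(K) θ`. Then `θ²` is even and commutes with `M_n(K)`, so it is a scalar `c`, and `c` determines
the product. If `c = 0`, the block is the semi-direct product, and the trace carries `B` to its
form; if `c ≠ 0`, rescaling by a square root of `c` gives `Q_n(K)`. -/

theorem Unitization.finiteDimensional (K R : Type*) [Field K] [NonUnitalRing R] [Module K R]
    [FiniteDimensional K R] : FiniteDimensional K (Unitization K R) :=
  Module.Finite.of_injective
    ({ toFun := Unitization.toProd, map_add' := fun _ _ => rfl, map_smul' := fun _ _ => rfl } :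
      Unitization K R →ₗ[K] K × R) Unitization.toProd_injective

/-- The unitization of a finite-dimensional algebra without nilpotent ideals is semisimple. -/
theorem IsSemisimpleAssocAlgebra.isSemisimpleRing_unitization
    (h : IsSemisimpleAssocAlgebra K R) : IsSemisimpleRing (Unitization K R) := by
  have := Unitization.finiteDimensional K R
  have : IsArtinianRing (Unitization K R) := IsArtinianRing.of_finite K _
  rw [IsArtinianRing.isSemisimpleRing_iff_jacobson]
  obtain ⟨k, hk⟩ := IsSemiprimaryRing.isNilpotent (R := Unitization K R)
  set J := Ring.jacobson (Unitization K R)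
  -- The radical is nilpotent, so the scalar component of each of its elements is nilpotent in the
  -- field `K`: the radical lies in `R`.
  have hfst : ∀ x ∈ J, x.fst = 0 := fun x hx => by
    have h1 : x ^ k = 0 := by
      have := Ideal.pow_mem_pow hx k
      rwa [hk] at this
    have h2 := congrArg (Unitization.fstHom K R) h1
    rw [map_pow, map_zero] at h2
    exact eq_zero_of_pow_eq_zero h2
  let I : Submodule K R := (J.restrictScalars K).comap (Unitization.inrHom K K R)
  have hI : ∀ x, x ∈ I ↔ (x : Unitization K R) ∈ J := fun x => Iff.rfl
  -- The exponent is shifted because `mulPow I j` is the power `I ^ (j + 1)`.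
  have hpow : ∀ j, ∀ x ∈ mulPow I j, (x : Unitization K R) ∈ J ^ (j + 1) := by
    intro j
    induction j with
    | zero =>
      intro x hx
      rw [zero_add, Submodule.pow_one]
      exact hx
    | succ j ih =>
      intro x hx
      refine Submodule.span_induction
        (p := fun (x : R) _ => (x : Unitization K R) ∈ J ^ (j + 1 + 1)) ?_ ?_ ?_ ?_ hx
      · rintro _ ⟨y, hy, z, hz, rfl⟩
        rw [Unitization.inr_mul, Ideal.IsTwoSided.pow_succ]
        exact Ideal.mul_mem_mul hy (ih z hz)
      · simp
      · intro y z _ _ hy hz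
        rw [Unitization.inr_add]
        exact add_mem hy hz
      · intro c y _ hy
        rw [Unitization.inr_smul]
        exact ((J ^ (j + 1 + 1)).restrictScalars K).smul_mem c hy
  have hI0 : I = ⊥ := by
    refine h I ⟨fun a x hx => ?_, fun a x hx => ?_⟩ ⟨k, ?_⟩
    · rw [hI, Unitization.inr_mul]
      exact J.mul_mem_left _ hx
    · rw [hI, Unitization.inr_mul]
      exact Ideal.mul_mem_right _ _ hx
    · rw [eq_bot_iff]
      intro x hx
      have h1 := hpow k x hx
      replace h1 := Ideal.pow_le_pow_right k.le_succ h1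
      rw [hk] at h1
      exact Unitization.inr_injective (R := K) (h1.trans (Unitization.inr_zero K).symm)
  rw [eq_bot_iff]
  intro x hx
  have hx1 : x = (x.snd : Unitization K R) := Unitization.ext (by simp [hfst x hx]) (by simp)
  have hx2 : x.snd ∈ I := by rw [hI, ← hx1]; exact hx
  rw [hI0, Submodule.mem_bot] at hx2
  rw [hx1, hx2]
  simp

/-- A finite-dimensional algebra without nilpotent ideals has a unit element. -/
theorem IsSemisimpleAssocAlgebra.exists_unit (h : IsSemisimpleAssocAlgebra K R) :
    ∃ e : R, ∀ x, e * x = x ∧ x * e = x := by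
  have := h.isSemisimpleRing_unitization
  -- `P` is the copy of `R`. Splitting `1 = p + q` along a complementary left ideal makes `p` a
  -- right unit: for `x` in `P`, the product `x q` lies in both `P` and `Q`.
  let P : Ideal (Unitization K R) := RingHom.ker (Unitization.fstHom K R)
  have hP : ∀ x, x ∈ P ↔ x.fst = 0 := fun x => Iff.rfl
  obtain ⟨Q, hQ⟩ := exists_isCompl P
  obtain ⟨p, hp, q, hq, hpq⟩ := Submodule.mem_sup.1 (hQ.sup_eq_top ▸ Submodule.mem_top (x := 1))
  have hpe : p = (p.snd : Unitization K R) := Unitization.ext (by simpa using (hP p).1 hp) (by simp)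
  have hr : ∀ x : R, x * p.snd = x := fun x => by
    have hxq : (x : Unitization K R) * q = 0 :=
      Submodule.disjoint_def.1 hQ.disjoint _
        ((hP _).2 (by simp)) (Q.mul_mem_left _ hq)
    have h1 : (x : Unitization K R) * (p + q) = x := by rw [hpq, mul_one]
    rw [mul_add, hxq, add_zero, hpe, ← Unitization.inr_mul] at h1
    exact Unitization.inr_injective h1
  let e := p.snd
  -- `N` measures the failure of the right unit `e` to be a left unit. Since `a x = (a e) x = a (e
  -- x)`, it is killed from the left by all of `R`, so it is an ideal of square zero (`mulPow N 1`).
  let N : Submodule K R := LinearMap.ker (LinearMap.mulLeft K e)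
  have hN : ∀ x, x ∈ N ↔ e * x = 0 := fun x => Iff.rfl
  have hRN : ∀ a x, x ∈ N → a * x = 0 := fun a x hx => by
    rw [← hr a, mul_assoc, (hN x).1 hx, mul_zero]
  have hN0 : N = ⊥ := by
    refine h N ⟨fun a x hx => ?_, fun a x hx => ?_⟩ ⟨1, ?_⟩
    · rw [hRN a x hx]; exact N.zero_mem
    · rw [hN, ← mul_assoc, (hN x).1 hx, zero_mul]
    · refine Submodule.span_eq_bot.2 ?_
      rintro _ ⟨x, _, y, hy, rfl⟩
      exact hRN x y hy
  refine ⟨e, fun x => ⟨?_, hr x⟩⟩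
  have hx : e * x - x ∈ N := by rw [hN, mul_sub, ← mul_assoc, hr e, sub_self]
  rw [hN0, Submodule.mem_bot] at hx
  exact sub_eq_zero.1 hx

/-- Wedderburn's theorem for finite-dimensional algebras without nilpotent ideals. -/
theorem IsSemisimpleAssocAlgebra.exists_linearEquiv_pi_matrix [IsAlgClosed K]
    (h : IsSemisimpleAssocAlgebra K R) :
    ∃ (m : ℕ) (d : Fin m → ℕ) (ψ : (Π i, Matrix (Fin (d i)) (Fin (d i)) K) ≃ₗ[K] R),
      (∀ i, 1 ≤ d i) ∧ ∀ a b, ψ (a * b) = ψ a * ψ b := by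
  obtain ⟨e, he⟩ := h.exists_unit
  let : Ring R :=
    { ‹NonUnitalRing R› with one := e, one_mul := fun x => (he x).1, mul_one := fun x => (he x).2 }
  let : Algebra K R := Algebra.ofModule smul_mul_assoc mul_smul_comm
  have := h.isSemisimpleRing_unitization
  -- As `R` is now unital, it is a quotient of its unitization and inherits semisimplicity.
  let f : Unitization K R →ₐ[K] R := Unitization.lift (NonUnitalAlgHom.id K R)
  have hf : Function.Surjective f := fun x => ⟨x, by simp [f]⟩
  have : IsSemisimpleRing R := f.toRingHom.isSemisimpleRing_of_surjective hf
  obtain ⟨m, d, hd, ⟨E⟩⟩ := IsSemisimpleRing.exists_algEquiv_pi_matrix_of_isAlgClosed K R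
  exact ⟨m, d, E.symm.toLinearEquiv, fun i => Nat.one_le_iff_ne_zero.2 (hd i).out,
    fun a b => map_mul E.symm a b⟩

end NonunitalSemisimple

/-! ### Odd-symmetric forms and the ideals cut out by even central idempotents. -/

section OddSymmetric

theorem ZMod.univ_eq_pair : (Set.univ : Set (ZMod 2)) = {0, 1} :=
  (Set.eq_univ_of_forall (by decide : ∀ i : ZMod 2, i = 0 ∨ i = 1)).symm

variable {K A : Type*} [Field K] [NonUnitalRing A] [Module K A]
  {𝒜 : ZMod 2 → Submodule K A} {B : LinearMap.BilinForm K A}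

theorem IsSuperalgebra.isCompl (h : IsSuperalgebra 𝒜) : IsCompl (𝒜 0) (𝒜 1) :=
  (DirectSum.isInternal_submodule_iff_isCompl 𝒜 zero_ne_one ZMod.univ_eq_pair).1 h.internal

theorem IsSuperalgebra.exists_add (h : IsSuperalgebra 𝒜) (x : A) :
    ∃ y ∈ 𝒜 0, ∃ z ∈ 𝒜 1, y + z = x :=
  Submodule.mem_sup.1 (h.isCompl.sup_eq_top ▸ Submodule.mem_top)

theorem IsSuperalgebra.eq_zero (h : IsSuperalgebra 𝒜) {x : A} (h0 : x ∈ 𝒜 0) (h1 : x ∈ 𝒜 1) :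
    x = 0 :=
  Submodule.disjoint_def.1 h.isCompl.disjoint x h0 h1

namespace IsOddSymmetric

theorem even_even (h : IsOddSymmetric 𝒜 B) {x y : A} (hx : x ∈ 𝒜 0) (hy : y ∈ 𝒜 0) : B x y = 0 :=
  h.odd 0 0 x y hx hy (by decide)

theorem odd_odd (h : IsOddSymmetric 𝒜 B) {x y : A} (hx : x ∈ 𝒜 1) (hy : y ∈ 𝒜 1) : B x y = 0 :=
  h.odd 1 1 x y hx hy (by decide)

/-- An odd supersymmetric form is symmetric. -/
theorem symm (h : IsOddSymmetric 𝒜 B) (x y : A) : B x y = B y x := by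
  obtain ⟨x0, hx0, x1, hx1, rfl⟩ := h.exists_add x
  obtain ⟨y0, hy0, y1, hy1, rfl⟩ := h.exists_add y
  have h1 := h.supersymm 0 1 _ _ hx0 hy1
  have h2 := h.supersymm 1 0 _ _ hx1 hy0
  simp only [ZMod.val_zero, zero_mul, mul_zero, pow_zero, one_mul] at h1 h2
  simp only [map_add, LinearMap.add_apply, h.even_even hx0 hy0, h.even_even hy0 hx0,
    h.odd_odd hx1 hy1, h.odd_odd hy1 hx1, h1, h2]
  ring

/-- Odd elements are orthogonal to each other, so non-degeneracy only has to be tested on the even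
part. This is how identities in the odd part are reduced to identities in the even one. -/
theorem odd_ext (h : IsOddSymmetric 𝒜 B) {x y : A} (hx : x ∈ 𝒜 1) (hy : y ∈ 𝒜 1)
    (hxy : ∀ z ∈ 𝒜 0, B x z = B y z) : x = y := by
  refine sub_eq_zero.1 (h.nondeg _ fun z => ?_)
  obtain ⟨z0, hz0, z1, hz1, rfl⟩ := h.exists_add z
  rw [map_add, h.odd_odd (sub_mem hx hy) hz1, map_sub, LinearMap.sub_apply, hxy z0 hz0, sub_self,
    add_zero]

/-- A central element of the even part is central. -/
theorem mul_comm_of_even (h : IsOddSymmetric 𝒜 B) {e : A} (he : e ∈ 𝒜 0)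
    (hc : ∀ x ∈ 𝒜 0, e * x = x * e) (x : A) : e * x = x * e := by
  obtain ⟨x0, hx0, x1, hx1, rfl⟩ := h.exists_add x
  rw [mul_add, add_mul, hc x0 hx0]
  congr 1
  refine h.odd_ext (by simpa using h.mul_mem 0 1 e x1 he hx1)
    (by simpa using h.mul_mem 1 0 x1 e hx1 he) fun z hz => ?_
  rw [h.assoc x1 e z, hc z hz, h.symm (e * x1), ← h.assoc, h.symm]

/-- A left unit of the even part is a left unit. -/
theorem one_mul_of_even (h : IsOddSymmetric 𝒜 B) {e : A} (he : e ∈ 𝒜 0)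
    (h1 : ∀ x ∈ 𝒜 0, e * x = x ∧ x * e = x) (x : A) : e * x = x := by
  obtain ⟨x0, hx0, x1, hx1, rfl⟩ := h.exists_add x
  rw [mul_add, (h1 x0 hx0).1]
  congr 1
  refine h.odd_ext (by simpa using h.mul_mem 0 1 e x1 he hx1) hx1 fun z hz => ?_
  rw [h.symm, ← h.assoc, (h1 z hz).2, h.symm]

/-- Pairwise orthogonal subspaces that span are independent. -/
theorem isInternal_of_orthogonal (h : IsOddSymmetric 𝒜 B) {ι : Type*} [DecidableEq ι]
    (I : ι → Submodule K A) (ho : ∀ i j, i ≠ j → ∀ x ∈ I i, ∀ y ∈ I j, B x y = 0)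
    (ht : ∀ x, x ∈ ⨆ i, I i) : DirectSum.IsInternal I := by
  rw [DirectSum.isInternal_submodule_iff_iSupIndep_and_iSup_eq_top]
  refine ⟨fun i => Submodule.disjoint_def.2 fun x hx hx' => h.nondeg x fun y => ?_,
    eq_top_iff.2 fun x _ => ht x⟩
  -- An `x` in `I i` and in the sum of the others is orthogonal to every `I j`: for `j ≠ i` by the
  -- first membership, for `j = i` by the second.
  have hle : ⨆ j, I j ≤ LinearMap.ker (B x) := iSup_le fun j y hy => by
    rw [LinearMap.mem_ker]
    by_cases hij : j = i
    · subst hij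
      have hle' : ⨆ k, ⨆ (_ : k ≠ j), I k ≤ LinearMap.ker (B y) :=
        iSup_le fun k => iSup_le fun hk z hz => ho j k hk.symm y hy z hz
      rw [h.symm]
      exact hle' hx'
    · exact ho i j (Ne.symm hij) x hx y hy
  exact hle (ht y)

end IsOddSymmetric

variable [SMulCommClass K A A]

/-- The subalgebra on which a given central element acts as a unit. -/
def fixedSubalgebra (K : Type*) {A : Type*} [Field K] [NonUnitalRing A] [Module K A]
    [SMulCommClass K A A] (e : A) : NonUnitalSubalgebra K A where
  carrier := {x | e * x = x}
  zero_mem' := mul_zero e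
  add_mem' := fun {x y} hx hy => by
    change e * (x + y) = x + y
    rw [mul_add, show e * x = x from hx, show e * y = y from hy]
  smul_mem' := fun c x hx => by
    change e * (c • x) = c • x
    rw [mul_smul_comm, show e * x = x from hx]
  mul_mem' := fun {x y} hx hy => by
    change e * (x * y) = x * y
    rw [← mul_assoc, show e * x = x from hx]

theorem mul_eq_of_mem_fixedSubalgebra {e x : A} (h : x ∈ fixedSubalgebra K e) : e * x = x := h

namespace IsOddSymmetric

theorem isGradedIdeal_fixed (h : IsOddSymmetric 𝒜 B) {e : A} (he : e ∈ 𝒜 0)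
    (hc : ∀ x, e * x = x * e) (hi : e * e = e) : IsGradedIdeal 𝒜 (fixedSubalgebra K e) where
  mul_mem_left := fun a x hx => by
    change e * (a * x) = a * x
    rw [← mul_assoc, hc a, mul_assoc, mul_eq_of_mem_fixedSubalgebra (K := K) hx]
  mul_mem_right := fun a x hx => by
    change e * (x * a) = x * a
    rw [← mul_assoc, mul_eq_of_mem_fixedSubalgebra (K := K) hx]
  graded := fun x hx => by
    obtain ⟨x0, hx0, x1, hx1, rfl⟩ := h.exists_add x
    rw [← mul_eq_of_mem_fixedSubalgebra (K := K) hx, mul_add]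
    have hf : ∀ y, e * y ∈ (fixedSubalgebra K e).toSubmodule := fun y => by
      change e * (e * y) = e * y
      rw [← mul_assoc, hi]
    exact Submodule.add_mem_sup ⟨hf x0, by simpa using h.mul_mem 0 0 e x0 he hx0⟩
      ⟨hf x1, by simpa using h.mul_mem 0 1 e x1 he hx1⟩

/-- Only non-degeneracy and the grading need `e`: for `x = e x = x e` one has `B(x, y) = B(x, e y)`,
so orthogonality to `e A` is orthogonality to `A`. -/
theorem restrict_fixed (h : IsOddSymmetric 𝒜 B) {e : A} (he : e ∈ 𝒜 0)
    (hc : ∀ x, e * x = x * e) (hi : e * e = e) :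
    IsOddSymmetric (restrictGrading 𝒜 (fixedSubalgebra K e))
      (restrictForm B (fixedSubalgebra K e)) where
  internal := by
    rw [DirectSum.isInternal_submodule_iff_isCompl _ (zero_ne_one (α := ZMod 2))
      ZMod.univ_eq_pair]
    refine ⟨Submodule.disjoint_def.2 fun x h0 h1 => Subtype.ext (h.eq_zero h0 h1), ?_⟩
    rw [codisjoint_iff, eq_top_iff]
    rintro ⟨x, hx⟩ -
    obtain ⟨y, ⟨hy, hy0⟩, z, ⟨hz, hz1⟩, rfl⟩ :=
      Submodule.mem_sup.1 ((h.isGradedIdeal_fixed he hc hi).graded hx)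
    exact Submodule.mem_sup.2 ⟨⟨y, hy⟩, hy0, ⟨z, hz⟩, hz1, rfl⟩
  mul_mem := fun i j x y hx hy => h.mul_mem i j x y hx hy
  odd := fun i j x y hx hy => h.odd i j x y hx hy
  supersymm := fun i j x y hx hy => h.supersymm i j x y hx hy
  assoc := fun x y z => h.assoc x y z
  nondeg := fun x hx => Subtype.ext <| h.nondeg x fun y => by
    have hy : e * y ∈ fixedSubalgebra K e := by
      change e * (e * y) = e * y
      rw [← mul_assoc, hi]
    have h1 : B x (e * y) = 0 := hx ⟨e * y, hy⟩
    rwa [← h.assoc, ← hc, mul_eq_of_mem_fixedSubalgebra x.2] at h1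

theorem fixed_orthogonal (h : IsOddSymmetric 𝒜 B) {e f : A} (hc : ∀ x, e * x = x * e)
    (hef : e * f = 0) {x y : A} (hx : x ∈ fixedSubalgebra K e) (hy : y ∈ fixedSubalgebra K f) :
    B x y = 0 := by
  rw [← mul_eq_of_mem_fixedSubalgebra (K := K) hx, ← mul_eq_of_mem_fixedSubalgebra (K := K) hy, hc, h.assoc, ← mul_assoc, hef,
    zero_mul, map_zero]

end IsOddSymmetric

end OddSymmetric

/-! ### Odd-symmetric superalgebras with even part `M_n(K)`. -/

section MatrixEvenPart

variable {K S : Type*} [Field K] [NonUnitalRing S] [Module K S]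
  {𝒮 : ZMod 2 → Submodule K S} {B : LinearMap.BilinForm K S}

theorem IsOddSymmetric.nondegenerate (h : IsOddSymmetric 𝒮 B) : B.Nondegenerate :=
  ⟨h.nondeg, fun x hx => h.nondeg x fun y => by rw [h.symm]; exact hx y⟩

/-- Every functional on the even part is represented by an odd element. -/
theorem IsOddSymmetric.exists_odd_form_eq [FiniteDimensional K S] (h : IsOddSymmetric 𝒮 B)
    {V : Type*} [AddCommGroup V] [Module K V] (φ : V →ₗ[K] S) (hφ : Function.Injective φ)
    (h0 : ∀ a, φ a ∈ 𝒮 0) (g : V →ₗ[K] K) : ∃ s ∈ 𝒮 1, ∀ a, B s (φ a) = g a := by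
  -- The left inverse `p` extends `g` to a functional on all of `S`. The even component of its
  -- representative pairs to zero with the image of `φ` and can be dropped.
  obtain ⟨p, hp⟩ := φ.exists_leftInverse_of_injective (LinearMap.ker_eq_bot.2 hφ)
  obtain ⟨s0, hs0, s1, hs1, hs⟩ := h.exists_add ((B.toDual h.nondegenerate).symm (g ∘ₗ p))
  refine ⟨s1, hs1, fun a => ?_⟩
  have h1 : B (s0 + s1) (φ a) = g (p (φ a)) := by
    rw [hs, LinearMap.BilinForm.apply_toDual_symm_apply]
    rfl
  rwa [map_add, LinearMap.add_apply, h.even_even hs0 (h0 a), zero_add,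
    show p (φ a) = a from LinearMap.congr_fun hp a] at h1

/-- The trace form identifies a matrix algebra with its dual space. -/
noncomputable def traceDualEquiv (K : Type*) [Field K] (n : ℕ) :
    Matrix (Fin n) (Fin n) K ≃ₗ[K] Module.Dual K (Matrix (Fin n) (Fin n) K) :=
  LinearEquiv.ofInjectiveOfFinrankEq
    ((LinearMap.mul K (Matrix (Fin n) (Fin n) K)).compr₂ (Matrix.traceLinearMap (Fin n) K K))
    (fun _ _ hab => Matrix.ext_iff_trace_mul_right.2 fun x => LinearMap.congr_fun hab x)
    Subspace.dual_finrank_eq.symm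

@[simp]
theorem traceDualEquiv_apply {n : ℕ} (a b : Matrix (Fin n) (Fin n) K) :
    traceDualEquiv K n a b = (a * b).trace := rfl

/-- The block matrices `(a μb; μb a)` parametrize the algebra `Q_n(K)`. -/
def queerEquiv (n : ℕ) (μ : Kˣ) :
    (Matrix (Fin n) (Fin n) K × Matrix (Fin n) (Fin n) K) ≃ₗ[K] queer K n where
  toFun p := ⟨Matrix.fromBlocks p.1 (μ • p.2) (μ • p.2) p.1, _, _, rfl⟩
  map_add' p q := Subtype.ext (by simp [Matrix.fromBlocks_add])
  map_smul' c p := Subtype.ext (by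
    simp [Matrix.fromBlocks_smul, smul_comm μ c p.2])
  invFun M := (M.1.toBlocks₁₁, μ⁻¹ • M.1.toBlocks₁₂)
  left_inv p := by simp
  right_inv := by
    rintro ⟨_, a, b, rfl⟩
    simp

/-- Superalgebras with the same coordinates, gradings and products are isomorphic. -/
def SuperalgebraIso.ofCoordinates {T V W : Type*} [NonUnitalRing T] [Module K T]
    [AddCommGroup V] [Module K V] [AddCommGroup W] [Module K W] {𝒯 : ZMod 2 → Submodule K T}
    (G : (V × W) ≃ₗ[K] S) (H : (V × W) ≃ₗ[K] T) (m : V × W → V × W → V × W)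
    (hG : ∀ p q, G p * G q = G (m p q)) (hH : ∀ p q, H p * H q = H (m p q))
    (hG0 : ∀ p, G p ∈ 𝒮 0 ↔ p.2 = 0) (hH0 : ∀ p, H p ∈ 𝒯 0 ↔ p.2 = 0)
    (hG1 : ∀ p, G p ∈ 𝒮 1 ↔ p.1 = 0) (hH1 : ∀ p, H p ∈ 𝒯 1 ↔ p.1 = 0) :
    SuperalgebraIso 𝒮 𝒯 where
  toLinearEquiv := G.symm.trans H
  map_mul x y := by
    obtain ⟨p, rfl⟩ := G.surjective x
    obtain ⟨q, rfl⟩ := G.surjective y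
    change H (G.symm (G p * G q)) = H (G.symm (G p)) * H (G.symm (G q))
    simp [hG, hH]
  mem_iff i x := by
    obtain ⟨p, rfl⟩ := G.surjective x
    change H (G.symm (G p)) ∈ 𝒯 i ↔ G p ∈ 𝒮 i
    rw [G.symm_apply_apply]
    obtain rfl | rfl : i = 0 ∨ i = 1 := by decide +revert
    · rw [hG0, hH0]
    · rw [hG1, hH1]

theorem SuperalgebraIso.ofCoordinates_apply {T V W : Type*} [NonUnitalRing T] [Module K T]
    [AddCommGroup V] [Module K V] [AddCommGroup W] [Module K W] {𝒯 : ZMod 2 → Submodule K T}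
    (G : (V × W) ≃ₗ[K] S) (H : (V × W) ≃ₗ[K] T) (m : V × W → V × W → V × W)
    (hG : ∀ p q, G p * G q = G (m p q)) (hH : ∀ p q, H p * H q = H (m p q))
    (hG0 : ∀ p, G p ∈ 𝒮 0 ↔ p.2 = 0) (hH0 : ∀ p, H p ∈ 𝒯 0 ↔ p.2 = 0)
    (hG1 : ∀ p, G p ∈ 𝒮 1 ↔ p.1 = 0) (hH1 : ∀ p, H p ∈ 𝒯 1 ↔ p.1 = 0) (p : V × W) :
    (SuperalgebraIso.ofCoordinates G H m hG hH hG0 hH0 hG1 hH1).toLinearEquiv (G p) = H p :=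
  congrArg H (G.symm_apply_apply p)

variable [IsScalarTower K S S]

/-- An odd-symmetric associative superalgebra whose even part is `M_n(K)` is generated over it by
an odd element that commutes with it, is dual to the trace and has a scalar square. -/
theorem IsOddSymmetric.exists_odd_generator [FiniteDimensional K S] (h : IsOddSymmetric 𝒮 B)
    {n : ℕ} (φ : Matrix (Fin n) (Fin n) K →ₗ[K] S) (hφ : Function.Injective φ)
    (hmul : ∀ a b, φ (a * b) = φ a * φ b) (h0 : ∀ x, x ∈ 𝒮 0 ↔ ∃ a, φ a = x) :
    ∃ (θ : S) (c : K) (G : (Matrix (Fin n) (Fin n) K × Matrix (Fin n) (Fin n) K) ≃ₗ[K] S),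
      (∀ p, G p = φ p.1 + φ p.2 * θ) ∧
      (∀ p q, G p * G q = G (p.1 * q.1 + c • (p.2 * q.2), p.1 * q.2 + p.2 * q.1)) ∧
      (∀ p, G p ∈ 𝒮 0 ↔ p.2 = 0) ∧ (∀ p, G p ∈ 𝒮 1 ↔ p.1 = 0) ∧
      ∀ p q, B (G p) (G q) = (p.2 * q.1).trace + (q.2 * p.1).trace := by
  have hφ0 : ∀ a, φ a ∈ 𝒮 0 := fun a => (h0 _).2 ⟨a, rfl⟩
  obtain ⟨θ, hθ, hBθ⟩ := h.exists_odd_form_eq φ hφ hφ0 (Matrix.traceLinearMap (Fin n) K K)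
  replace hBθ : ∀ a, B θ (φ a) = a.trace := hBθ
  have hφθ : ∀ a, φ a * θ ∈ 𝒮 1 := fun a => by simpa using h.mul_mem 0 1 _ _ (hφ0 a) hθ
  have hB : ∀ a b, B (φ a * θ) (φ b) = (a * b).trace := fun a b => by
    rw [h.symm, ← h.assoc, ← hmul, h.symm, hBθ, Matrix.trace_mul_comm]
  -- Paired with `φ b`, both sides give the trace of `a b`.
  have hcomm : ∀ a, θ * φ a = φ a * θ := fun a =>
    h.odd_ext (by simpa using h.mul_mem 1 0 _ _ hθ (hφ0 a)) (hφθ a) fun z hz => by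
      obtain ⟨b, rfl⟩ := (h0 z).1 hz
      rw [hB, h.assoc, ← hmul, hBθ]
  have hodd : ∀ s ∈ 𝒮 1, ∃ b, φ b * θ = s := fun s hs => by
    obtain ⟨b, hb⟩ := (traceDualEquiv K n).surjective (B s ∘ₗ φ)
    refine ⟨b, h.odd_ext (hφθ b) hs fun z hz => ?_⟩
    obtain ⟨a, rfl⟩ := (h0 z).1 hz
    rw [hB, ← traceDualEquiv_apply, hb]
    rfl
  have hinj : ∀ b, φ b * θ = 0 → b = 0 := fun b hb =>
    Matrix.ext_iff_trace_mul_right.2 fun x => by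
      rw [← hB, hb, map_zero, LinearMap.zero_apply, zero_mul, Matrix.trace_zero]
  -- `t` commutes with all matrix units because `θ`, hence `θ²`, commutes with the image of `φ`; so
  -- `t` is the scalar matrix `c`.
  obtain ⟨t, ht⟩ := (h0 (θ * θ)).1 (h.mul_mem 1 1 _ _ hθ hθ)
  obtain ⟨c, hc⟩ := Matrix.mem_range_scalar_iff_commute_single'.2
    (fun i j => show Matrix.single i j 1 * t = t * Matrix.single i j 1 from hφ (by
      rw [hmul, hmul, ht, ← mul_assoc, ← hcomm, mul_assoc, ← hcomm, mul_assoc]))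
  have hsq : ∀ a, φ a * (θ * θ) = φ (c • a) := fun a => by
    rw [← ht, ← hmul, ← hc]
    congr 1
    ext i j
    simp [mul_comm]
  let G₀ : (Matrix (Fin n) (Fin n) K × Matrix (Fin n) (Fin n) K) →ₗ[K] S :=
    φ.coprod (LinearMap.mulRight K θ ∘ₗ φ)
  have hG₀ : ∀ p, G₀ p = φ p.1 + φ p.2 * θ := fun p => rfl
  have hG1 : ∀ p, G₀ p ∈ 𝒮 1 ↔ p.1 = 0 := fun p => by
    rw [hG₀, Submodule.add_mem_iff_left _ (hφθ p.2)]
    refine ⟨fun hp => hφ ((h.eq_zero (hφ0 _) hp).trans (map_zero φ).symm), fun hp => ?_⟩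
    rw [hp, map_zero]
    exact zero_mem _
  have hG0 : ∀ p, G₀ p ∈ 𝒮 0 ↔ p.2 = 0 := fun p => by
    rw [hG₀, Submodule.add_mem_iff_right _ (hφ0 p.1)]
    refine ⟨fun hp => hinj _ (h.eq_zero hp (hφθ _)), fun hp => ?_⟩
    rw [hp, map_zero, zero_mul]
    exact zero_mem _
  have hbij : Function.Bijective G₀ := by
    refine ⟨(injective_iff_map_eq_zero G₀).2 fun p hp => ?_, fun x => ?_⟩
    · exact Prod.ext ((hG1 p).1 (hp ▸ zero_mem _)) ((hG0 p).1 (hp ▸ zero_mem _))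
    · obtain ⟨x0, hx0, x1, hx1, rfl⟩ := h.exists_add x
      obtain ⟨a, rfl⟩ := (h0 x0).1 hx0
      obtain ⟨b, rfl⟩ := hodd x1 hx1
      exact ⟨(a, b), rfl⟩
  refine ⟨θ, c, LinearEquiv.ofBijective G₀ hbij, hG₀, fun p q => ?_, hG0, hG1, fun p q => ?_⟩
  · have h1 : φ p.1 * (φ q.2 * θ) = φ (p.1 * q.2) * θ := by rw [hmul, mul_assoc]
    have h2 : φ p.2 * θ * φ q.1 = φ (p.2 * q.1) * θ := by
      rw [mul_assoc, hcomm, hmul, mul_assoc]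
    have h3 : φ p.2 * θ * (φ q.2 * θ) = φ (c • (p.2 * q.2)) := by
      rw [← hsq, hmul, mul_assoc, ← mul_assoc θ, hcomm, mul_assoc, mul_assoc]
    simp only [LinearEquiv.ofBijective_apply, hG₀, mul_add, add_mul, h1, h2, h3, ← hmul, map_add]
    abel
  · simp only [LinearEquiv.ofBijective_apply, hG₀, map_add, LinearMap.add_apply, hB,
      h.even_even (hφ0 _) (hφ0 _), h.odd_odd (hφθ _) (hφθ _), h.symm (φ p.1) (φ q.2 * θ)]
    ring

theorem queerEquiv_mem_zero {n : ℕ} {μ : Kˣ}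
    (p : Matrix (Fin n) (Fin n) K × Matrix (Fin n) (Fin n) K) :
    queerEquiv n μ p ∈ queerGrading K n 0 ↔ p.2 = 0 := by
  change (∃ a, Matrix.fromBlocks p.1 (μ • p.2) (μ • p.2) p.1 = _) ↔ _
  simp [Matrix.fromBlocks_inj, smul_eq_zero_iff_eq]

theorem queerEquiv_mem_one {n : ℕ} {μ : Kˣ}
    (p : Matrix (Fin n) (Fin n) K × Matrix (Fin n) (Fin n) K) :
    queerEquiv n μ p ∈ queerGrading K n 1 ↔ p.1 = 0 := by
  change (∃ b, Matrix.fromBlocks p.1 (μ • p.2) (μ • p.2) p.1 = _) ↔ _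
  simp [Matrix.fromBlocks_inj]

/-- The trace form parametrizes the semi-direct product of `M_n(K)` by its dual. -/
noncomputable def semidirectEquiv (K : Type*) [Field K] (n : ℕ) :
    (Matrix (Fin n) (Fin n) K × Matrix (Fin n) (Fin n) K) ≃ₗ[K]
      SemidirectDual K (Matrix (Fin n) (Fin n) K) :=
  (LinearEquiv.refl K (Matrix (Fin n) (Fin n) K)).prodCongr (traceDualEquiv K n)

theorem semidirectEquiv_mul {n : ℕ}
    (p q : Matrix (Fin n) (Fin n) K × Matrix (Fin n) (Fin n) K) :
    semidirectEquiv K n p * semidirectEquiv K n q =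
      semidirectEquiv K n (p.1 * q.1, p.1 * q.2 + p.2 * q.1) := by
  refine Prod.ext rfl (LinearMap.ext fun z => ?_)
  change (q.2 * (z * p.1)).trace + (p.2 * (q.1 * z)).trace = ((p.1 * q.2 + p.2 * q.1) * z).trace
  rw [add_mul, Matrix.trace_add, ← mul_assoc q.2, Matrix.trace_mul_comm _ p.1, mul_assoc p.1,
    mul_assoc p.2]

theorem semidirectEquiv_mem_zero {n : ℕ}
    (p : Matrix (Fin n) (Fin n) K × Matrix (Fin n) (Fin n) K) :
    semidirectEquiv K n p ∈ SemidirectDual.grading K (Matrix (Fin n) (Fin n) K) 0 ↔ p.2 = 0 := by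
  change (∃ a, ((a, 0) : _ × _) = (p.1, traceDualEquiv K n p.2)) ↔ _
  simp [Prod.ext_iff, eq_comm (a := (0 : Module.Dual K _))]

theorem semidirectEquiv_mem_one {n : ℕ}
    (p : Matrix (Fin n) (Fin n) K × Matrix (Fin n) (Fin n) K) :
    semidirectEquiv K n p ∈ SemidirectDual.grading K (Matrix (Fin n) (Fin n) K) 1 ↔ p.1 = 0 := by
  change (∃ f, ((0, f) : _ × _) = (p.1, traceDualEquiv K n p.2)) ↔ _
  simp [Prod.ext_iff, eq_comm (a := (0 : Matrix _ _ K))]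

/-- An odd-symmetric associative superalgebra with even part `M_n(K)` is either `Q_n(K)` or the
semi-direct product of `M_n(K)` by its dual. -/
theorem IsOddSymmetric.iso_queer_or_semidirect [IsAlgClosed K] [FiniteDimensional K S]
    (h : IsOddSymmetric 𝒮 B) {n : ℕ} (φ : Matrix (Fin n) (Fin n) K →ₗ[K] S)
    (hφ : Function.Injective φ) (hmul : ∀ a b, φ (a * b) = φ a * φ b)
    (h0 : ∀ x, x ∈ 𝒮 0 ↔ ∃ a, φ a = x) :
    Nonempty (SuperalgebraIso 𝒮 (queerGrading K n)) ∨
      ∃ e : SuperalgebraIso 𝒮 (SemidirectDual.grading K (Matrix (Fin n) (Fin n) K)),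
        ∀ x y : S, SemidirectDual.form K (Matrix (Fin n) (Fin n) K)
          (e.toLinearEquiv x) (e.toLinearEquiv y) = B x y := by
  obtain ⟨θ, c, G, -, hGm, hG0, hG1, hGB⟩ := h.exists_odd_generator φ hφ hmul h0
  by_cases hc : c = 0
  · refine Or.inr ⟨SuperalgebraIso.ofCoordinates G (semidirectEquiv K n) _ hGm
      (fun p q => by rw [semidirectEquiv_mul, hc, zero_smul, add_zero]) hG0
      semidirectEquiv_mem_zero hG1 semidirectEquiv_mem_one, fun x y => ?_⟩
    obtain ⟨p, rfl⟩ := G.surjective x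
    obtain ⟨q, rfl⟩ := G.surjective y
    rw [SuperalgebraIso.ofCoordinates_apply, SuperalgebraIso.ofCoordinates_apply, hGB, add_comm]
    rfl
  -- With `r² = c`, the odd coordinate `b` goes to the off-diagonal block `r b`, so that products of
  -- two odd elements pick up the factor `c`.
  · obtain ⟨r, hr⟩ := IsAlgClosed.exists_pow_nat_eq c two_pos
    have hr0 : r ≠ 0 := by
      rintro rfl
      exact hc (by simpa using hr.symm)
    refine Or.inl ⟨SuperalgebraIso.ofCoordinates G (queerEquiv n (Units.mk0 r hr0)) _ hGm
      (fun p q => Subtype.ext ?_) hG0 queerEquiv_mem_zero hG1 queerEquiv_mem_one⟩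
    change Matrix.fromBlocks p.1 (r • p.2) (r • p.2) p.1
      * Matrix.fromBlocks q.1 (r • q.2) (r • q.2) q.1 = Matrix.fromBlocks _ _ _ _
    rw [Matrix.fromBlocks_multiply, ← hr]
    have h1 : p.1 * q.1 + r • p.2 * r • q.2 = p.1 * q.1 + r ^ 2 • (p.2 * q.2) := by
      rw [smul_mul_smul_comm, sq]
    have h2 : p.1 * r • q.2 + r • p.2 * q.1 = r • (p.1 * q.2 + p.2 * q.1) := by
      rw [mul_smul_comm, smul_mul_assoc, smul_add]
    congr 1
    · rw [add_comm, h2]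
      rfl
    · rw [add_comm, h1]

end MatrixEvenPart

/-! ### Decomposition of `A` along the simple blocks of its even part. -/

theorem mainTheorem9 {K A : Type*} [Field K] [IsAlgClosed K] [CharZero K]
    [NonUnitalRing A] [Module K A] [IsScalarTower K A A] [SMulCommClass K A A]
    [FiniteDimensional K A]
    (𝒜 : ZMod 2 → Submodule K A) (B : LinearMap.BilinForm K A)
    (hAB : IsOddSymmetric 𝒜 B)
    (hss : IsSemisimpleAssocAlgebra K hAB.toIsSuperalgebra.evenPart) :
    ∃ (m : ℕ) (I : Fin m → NonUnitalSubalgebra K A),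
      (∀ i, IsGradedIdeal 𝒜 (I i)) ∧
      DirectSum.IsInternal (fun i => (I i).toSubmodule) ∧
      (∀ i j, i ≠ j → ∀ x ∈ I i, ∀ y ∈ I j, B x y = 0) ∧
      (∀ i, IsOddSymmetric (restrictGrading 𝒜 (I i)) (restrictForm B (I i))) ∧
      ∀ i, ∃ n : ℕ, 1 ≤ n ∧
        (Nonempty (SuperalgebraIso (restrictGrading 𝒜 (I i)) (queerGrading K n)) ∨
          ∃ e : SuperalgebraIso (restrictGrading 𝒜 (I i))
              (SemidirectDual.grading K (Matrix (Fin n) (Fin n) K)),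
            ∀ x y : I i,
              SemidirectDual.form K (Matrix (Fin n) (Fin n) K)
                (e.toLinearEquiv x) (e.toLinearEquiv y) = restrictForm B (I i) x y) := by
  have : FiniteDimensional K hAB.toIsSuperalgebra.evenPart :=
    inferInstanceAs (FiniteDimensional K (𝒜 0))
  obtain ⟨m, d, ψ, hd, hψ⟩ := hss.exists_linearEquiv_pi_matrix
  have hψA : ∀ a b, ((ψ (a * b) : _) : A) = ψ a * ψ b := fun a b => congrArg Subtype.val (hψ a b)
  have hψ0 : ∀ a, (ψ a : A) ∈ 𝒜 0 := fun a => (ψ a).2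
  have hsurj : ∀ x ∈ 𝒜 0, ∃ a, (ψ a : A) = x := fun x hx =>
    (ψ.surjective ⟨x, hx⟩).imp fun a ha => congrArg Subtype.val ha
  -- The units of the matrix blocks: orthogonal idempotents, central in the even part, with sum the
  -- unit `ψ 1`.
  let e : Fin m → A := fun i => ψ (Pi.single i 1)
  have hsingle : ∀ i (a : Π i, Matrix (Fin (d i)) (Fin (d i)) K),
      Pi.single i 1 * a = Pi.single i (a i) := fun i a => by
    rw [← Pi.single_mul_left, one_mul]
  have hsingle' : ∀ i (a : Π i, Matrix (Fin (d i)) (Fin (d i)) K),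
      a * Pi.single i 1 = Pi.single i (a i) := fun i a => by
    rw [← Pi.single_mul_right, mul_one]
  have he0 : ∀ i, e i ∈ 𝒜 0 := fun i => hψ0 _
  have hc : ∀ i x, e i * x = x * e i := fun i =>
    hAB.mul_comm_of_even (he0 i) fun x hx => by
      obtain ⟨a, rfl⟩ := hsurj x hx
      rw [← hψA, ← hψA, hsingle, hsingle']
  have hi : ∀ i, e i * e i = e i := fun i => by
    rw [← hψA, hsingle, Pi.single_eq_same]
  have hij : ∀ i j, i ≠ j → e i * e j = 0 := fun i j h => by
    rw [← hψA, hsingle, Pi.single_eq_of_ne h, Pi.single_zero, map_zero]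
    rfl
  have hone : ∀ x, (ψ 1 : A) * x = x := hAB.one_mul_of_even (hψ0 1) fun x hx => by
    obtain ⟨a, rfl⟩ := hsurj x hx
    rw [← hψA, ← hψA, one_mul, mul_one]
    exact ⟨rfl, rfl⟩
  have hsum : (ψ 1 : A) = ∑ i, e i := by
    have h1 : (1 : Π i, Matrix (Fin (d i)) (Fin (d i)) K) = ∑ i, Pi.single i 1 :=
      (Finset.univ_sum_single 1).symm
    rw [h1, map_sum]
    exact map_sum (NonUnitalSubalgebraClass.subtype hAB.toIsSuperalgebra.evenPart) _ _
  have hort : ∀ i j, i ≠ j → ∀ x ∈ fixedSubalgebra K (e i), ∀ y ∈ fixedSubalgebra K (e j),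
      B x y = 0 := fun i j h x hx y hy => hAB.fixed_orthogonal (hc i) (hij i j h) hx hy
  refine ⟨m, fun i => fixedSubalgebra K (e i),
    fun i => hAB.isGradedIdeal_fixed (he0 i) (hc i) (hi i),
    hAB.isInternal_of_orthogonal _ hort fun x => ?_, hort,
    fun i => hAB.restrict_fixed (he0 i) (hc i) (hi i), fun i => ⟨d i, hd i, ?_⟩⟩
  · rw [← hone x, hsum, Finset.sum_mul]
    refine sum_mem fun i _ => Submodule.mem_iSup_of_mem i ?_
    change e i * (e i * x) = e i * x
    rw [← mul_assoc, hi]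
  · have hmem : ∀ a, (ψ (Pi.single i a) : A) ∈ fixedSubalgebra K (e i) := fun a => by
      change e i * _ = _
      rw [← hψA, hsingle, Pi.single_eq_same]
    let φ : Matrix (Fin (d i)) (Fin (d i)) K →ₗ[K] fixedSubalgebra K (e i) :=
      { toFun := fun a => ⟨ψ (Pi.single i a), hmem a⟩
        map_add' := fun a b => Subtype.ext (by simp [Pi.single_add])
        map_smul' := fun c a => Subtype.ext (by simp [Pi.single_smul]) }
    have : FiniteDimensional K (fixedSubalgebra K (e i)) :=
      inferInstanceAs (FiniteDimensional K (fixedSubalgebra K (e i)).toSubmodule)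
    refine (hAB.restrict_fixed (he0 i) (hc i) (hi i)).iso_queer_or_semidirect φ
      (fun a b hab => ?_) (fun a b => Subtype.ext ?_) fun x => ⟨fun hx => ?_, ?_⟩
    · have h1 := Subtype.ext_iff.1 hab
      exact Pi.single_injective i (ψ.injective (Subtype.ext h1))
    · change (ψ (Pi.single i (a * b)) : A) = ψ (Pi.single i a) * ψ (Pi.single i b)
      rw [← hψA, Pi.single_mul]
    -- An even `x = ψ a` with `e i * x = x` has only its block `a i`, because multiplying by `e i`
    -- erases the other blocks.
    · obtain ⟨a, ha⟩ := hsurj x.1 hx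
      refine ⟨a i, Subtype.ext ?_⟩
      change (ψ (Pi.single i (a i)) : A) = x
      rw [← hsingle, hψA, ha]
      exact x.2
    · rintro ⟨a, rfl⟩
      exact hψ0 _
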